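/- **Setting.** A disjunctive ASP program $P$ is a finite set of rules $p_1(\bar t_1)\vee\dots\vee p_n(\bar t_n)\leftarrow q_1(\bar s_1),\dots,q_j(\bar s_j),\ \mathrm{not}\,q_{j+1}(\bar s_{j+1}),\dots,\mathrm{not}\,q_m(\bar s_m)$ with $n\ge 1$, $m\ge j\ge 0$, whose arguments are variables and constants; $H(r)$, $B^+(r)$, $B^-(r)$ are the sets of head, positive body and negated body atoms of $r$, and $\mathrm{At}(r)$ is their union. A fact is a rule with empty body and a single, variable-free head atom. The universe $U_P$ is the set of constants of $P$ (one arbitrary constant if there is none), the base $B_P$ is the set of ground atoms with predicates of $P$ and arguments in $U_P$, and $\mathrm{Ground}(P)$ is the set of all instances of rules of $P$ over $U_P$. For $M\subseteq B_P$ the reduct $\mathrm{Ground}(P)^M$ is obtained by deleting the ground rules with a negated body atom in $M$ and dropping the negative literals of the others; $M$ is an answer set of $P$ if it is a subset-minimal model of $\mathrm{Ground}(P)^M$. $P$ is super-consistent if $P\cup F$ has an answer set for every finite set $F$ of facts, over arbitrary predicate symbols (including symbols that do not occur in $P$). A predicate is an EDB predicate of $P$ if every rule of $P$ with that predicate in the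 head is a fact, otherwise an IDB predicate; $\mathrm{EDB}(P)$ is the set of rules of $P$ with no IDB predicate in the head. A query is an atom $Q=g(\bar t)$. Programs $P,P'$ are brave-equivalent (cautious-equivalent) w.r.t. $Q$ if, for every finite set $F$ of facts whose predicates are EDB predicates of $P$ or of $P'$, the same substitutions $\vartheta$ of constants for the variables of $Q$ make $Q\vartheta$ true in some (in every) answer set of $P\cup F$ and of $P'\cup F$. **Rewriting.** An adornment $\alpha$ of a predicate marks each argument position bound or free. For each adorned predicate $p^\alpha$ let $\mathit{magic}\_p^\alpha$ be a new predicate; $\mathit{magic}(p^\alpha(\bar t))$ is the atom with this predicate and the arguments of $\bar t$ at the bound positions. Fix, for each rule $r$, each $a=p(\bar t)\in H(r)$ and each adornment $\alpha$ of $p$, a SIPS $(\prec,f)$: a strict partial order $\prec$ on $\mathrm{At}(r)$ such that $a\prec b$ for all $b\ne a$, and no atom of $H(r)\cup B^-(r)$ other than $a$ precedes any atom; and a map $f$ assigning to each $b\in\mathrm{At}(r)$ a set of variables of $b$. It adorns an atom $b$ of $r$ (other than the head occurrence $a$, which keeps $\alpha$) with $\alpha_b$, in which an argument is bound iff it is a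 constant, or a variable in $f(a)$, or a variable in $f(c)$ for some $c\in B^+(r)$ with $c\prec b$. Let $S$ be the least set of adorned predicates that contains $g^{\alpha_Q}$, where $\alpha_Q$ marks exactly the constants of $Q$ as bound, and such that, whenever $p^\alpha\in S$, $r\in P$ and $a=p(\bar t)\in H(r)$, the predicate of every atom $b\in (H(r)\setminus\{a\})\cup B^+(r)\cup B^-(r)$ with an IDB predicate (of any arity, including $0$), adorned with $\alpha_b$, is in $S$. Then $\mathrm{DMS}(Q,P)$ consists of the magic seed $\mathit{magic}(g^{\alpha_Q}(\bar t))$; for all such $p^\alpha,r,a,b$, the magic rule with head $\mathit{magic}(b^{\alpha_b})$ and body $\{\mathit{magic}(a^\alpha)\}\cup\{c\in\mathrm{At}(r): c\prec b,\ c\neq a\}$; for all such $p^\alpha,r,a$, the modified rule obtained from $r$ by adding $\mathit{magic}(a^\alpha)$ and all $\mathit{magic}(b^{\alpha_b})$, $b\in H(r)\setminus\{a\}$, to the positive body; and the rules of $\mathrm{EDB}(P)$. **Theorem.** Let $P$ be a super-consistent program and $Q$ a query all of whose constants occur in $P$. Assume that $P$ is safe (each variable of a rule occurs in a positive body atom of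 that rule) or, if not, that every constant of $P$ occurs in $\mathrm{DMS}(Q,P)$. Then, for every choice of SIPS, $\mathrm{DMS}(Q,P)$ and $P$ are brave-equivalent and cautious-equivalent with respect to $Q$. -/

import Mathlib

namespace ASP

/-! ### Terms, atoms, rules, programs

Predicate symbols form a type `Pr`; `Pos p` is the finite type of argument positions of `p`
(for a predicate of arity `k`, think of `Fin k`).  `V` is the type of variables and `C` the type
of constants. -/

/-- A term is a variable or a constant. -/
inductive Term (V C : Type*) where
  | var (x : V) : Term V C
  | const (c : C) : Term V C

/-- An atom `p(t)` with arguments in `T`.  `T = Term V C` gives atoms, `T = C` ground atoms. -/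
structure Atom {Pr : Type*} (Pos : Pr → Type*) (T : Type*) where
  pred : Pr
  args : Pos pred → T

/-- A disjunctive rule with nonempty head, given by its sets of head atoms, positive body atoms and
negated body atoms.  `T = Term V C` gives rules, `T = C` ground rules. -/
structure Rule {Pr : Type*} (Pos : Pr → Type*) (T : Type*) where
  head : Finset (Atom Pos T)
  pos : Finset (Atom Pos T)
  neg : Finset (Atom Pos T)
  head_nonempty : head.Nonempty

section Basic

variable {Pr : Type*} {Pos : Pr → Type*} {T T' V C : Type*}

/-- Apply a map to all arguments of an atom. -/
def Atom.map (h : T → T') (a : Atom Pos T) : Atom Pos T' := ⟨a.pred, fun i => h (a.args i)⟩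

open scoped Classical in
/-- Apply a map to all arguments of all atoms of a rule. -/
noncomputable def Rule.map (h : T → T') (r : Rule Pos T) : Rule Pos T' where
  head := r.head.image (Atom.map h)
  pos := r.pos.image (Atom.map h)
  neg := r.neg.image (Atom.map h)
  head_nonempty := r.head_nonempty.image _

open scoped Classical in
/-- The set of all atoms occurring in a rule. -/
noncomputable def Rule.atoms (r : Rule Pos T) : Finset (Atom Pos T) := r.head ∪ r.pos ∪ r.neg

/-- Variables of an atom. -/
def Atom.vars (a : Atom Pos (Term V C)) : Set V := {x | ∃ i, a.args i = Term.var x}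

/-- Constants of an atom. -/
def Atom.consts (a : Atom Pos (Term V C)) : Set C := {c | ∃ i, a.args i = Term.const c}

/-- Variables of a rule. -/
def Rule.vars (r : Rule Pos (Term V C)) : Set V := {x | ∃ a ∈ r.atoms, x ∈ a.vars}

/-- A fact: empty body, exactly one head atom, no variable in the head. -/
def Rule.IsFact (r : Rule Pos (Term V C)) : Prop :=
  r.pos = ∅ ∧ r.neg = ∅ ∧ r.head.card = 1 ∧ ∀ a ∈ r.head, a.vars = ∅

/-- A rule is safe if each of its variables occurs in a positive body atom. -/
def Rule.Safe (r : Rule Pos (Term V C)) : Prop :=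
  ∀ x ∈ r.vars, ∃ a ∈ r.pos, x ∈ a.vars

/-- The fact (as a rule) with the given ground head atom. -/
def factRule (A : Atom Pos C) : Rule Pos (Term V C) where
  head := {A.map Term.const}
  pos := ∅
  neg := ∅
  head_nonempty := Finset.singleton_nonempty _

/-- A program as a set of rules; programs are finite, and finiteness is stated where programs are
quantified over. -/
abbrev Program {Pr : Type*} (Pos : Pr → Type*) (V C : Type*) := Set (Rule Pos (Term V C))

/-- The program `P ∪ F` for a set `F` of facts, given by their ground head atoms. -/
def withFacts (P : Program Pos V C) (F : Set (Atom Pos C)) : Program Pos V C :=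
  P ∪ factRule '' F

/-- A program is safe if all its rules are. -/
def SafeProgram (P : Program Pos V C) : Prop := ∀ r ∈ P, r.Safe

/-- `p` is an EDB predicate of `P`: all rules of `P` with `p` in the head are facts. -/
def IsEDB (P : Program Pos V C) (p : Pr) : Prop :=
  ∀ r ∈ P, (∃ a ∈ r.head, a.pred = p) → r.IsFact

/-- The rules of `P` without IDB predicate in the head. -/
def EDB (P : Program Pos V C) : Program Pos V C := {r ∈ P | ∀ a ∈ r.head, IsEDB P a.pred}

/-! ### Grounding and answer sets -/

/-- Constants occurring in a program. -/
def programConsts (P : Program Pos V C) : Set C := {c | ∃ r ∈ P, ∃ a ∈ r.atoms, c ∈ a.consts}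

/-- The universe of a program: its constants, or a single arbitrary constant if it has none. -/
def programUniverse [Inhabited C] (P : Program Pos V C) : Set C :=
  {c | c ∈ programConsts P ∨ (programConsts P = ∅ ∧ c = default)}

/-- The base of a program: ground atoms over its predicates and its universe. -/
def programBase [Inhabited C] (P : Program Pos V C) : Set (Atom Pos C) :=
  {A | (∃ r ∈ P, ∃ a ∈ r.atoms, a.pred = A.pred) ∧ ∀ i, A.args i ∈ programUniverse P}

/-- Evaluate a term under a substitution of constants for variables. -/
def Term.subst (θ : V → C) : Term V C → C
  | .var x => θ x
  | .const c => c

/-- All instances of the rules of `P` over the universe of `P`.  Only the values of `θ` at the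
variables of the rule matter. -/
def ground [Inhabited C] (P : Program Pos V C) : Set (Rule Pos C) :=
  {s | ∃ r ∈ P, ∃ θ : V → C, (∀ x ∈ r.vars, θ x ∈ programUniverse P) ∧ s = r.map (Term.subst θ)}

/-- The body of a ground rule is true with respect to `I`. -/
def Rule.BodyTrue (s : Rule Pos C) (I : Set (Atom Pos C)) : Prop :=
  (∀ a ∈ s.pos, a ∈ I) ∧ ∀ a ∈ s.neg, a ∉ I

/-- `I` satisfies all ground rules in `G`. -/
def Models (G : Set (Rule Pos C)) (I : Set (Atom Pos C)) : Prop :=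
  ∀ s ∈ G, s.BodyTrue I → ∃ a ∈ s.head, a ∈ I

/-- The reduct of a ground program with respect to `I`: delete the rules with a negated body atom in
`I` and drop the negative literals of the others. -/
def reduct (G : Set (Rule Pos C)) (I : Set (Atom Pos C)) : Set (Rule Pos C) :=
  {s' | ∃ s ∈ G, (∀ a ∈ s.neg, a ∉ I) ∧ s' = ⟨s.head, s.pos, ∅, s.head_nonempty⟩}

/-- The answer sets of a program: interpretations that are subset-minimal models of the reduct. -/
def answerSets [Inhabited C] (P : Program Pos V C) : Set (Set (Atom Pos C)) :=
  {M | M ⊆ programBase P ∧ Minimal (Models (reduct (ground P) M)) M}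

/-- Super-consistency: adding any (finite) set of facts gives a program with an answer set. -/
def SuperConsistent [Inhabited C] (P : Program Pos V C) : Prop :=
  ∀ F : Set (Atom Pos C), F.Finite → (answerSets (withFacts P F)).Nonempty

/-! ### Queries -/

/-- Brave consequence. -/
def BraveConsequence [Inhabited C] (P : Program Pos V C) (A : Atom Pos C) : Prop :=
  ∃ M ∈ answerSets P, A ∈ M

/-- Cautious consequence. -/
def CautiousConsequence [Inhabited C] (P : Program Pos V C) (A : Atom Pos C) : Prop :=
  ∀ M ∈ answerSets P, A ∈ M

/-- Brave answers to the query `Q`, as a set of substitutions.  Only the values at the variables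
of `Q` matter. -/
def braveAnswers [Inhabited C] (Q : Atom Pos (Term V C)) (P : Program Pos V C) : Set (V → C) :=
  {θ | BraveConsequence P (Q.map (Term.subst θ))}

/-- Cautious answers to the query `Q`, as a set of substitutions. -/
def cautiousAnswers [Inhabited C] (Q : Atom Pos (Term V C)) (P : Program Pos V C) : Set (V → C) :=
  {θ | CautiousConsequence P (Q.map (Term.subst θ))}

/-- `F` is a finite set of facts over the EDB predicates of `P` and `P'`; each predicate of `F` is
an EDB predicate of at least one of the two programs. -/
def FactsOverEDB (P P' : Program Pos V C) (F : Set (Atom Pos C)) : Prop :=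
  F.Finite ∧ ∀ A ∈ F, IsEDB P A.pred ∨ IsEDB P' A.pred

/-- Brave equivalence of two programs with respect to a query. -/
def BraveEquiv [Inhabited C] (Q : Atom Pos (Term V C)) (P P' : Program Pos V C) : Prop :=
  ∀ F, FactsOverEDB P P' F →
    braveAnswers Q (withFacts P F) = braveAnswers Q (withFacts P' F)

/-- Cautious equivalence of two programs with respect to a query. -/
def CautiousEquiv [Inhabited C] (Q : Atom Pos (Term V C)) (P P' : Program Pos V C) : Prop :=
  ∀ F, FactsOverEDB P P' F →
    cautiousAnswers Q (withFacts P F) = cautiousAnswers Q (withFacts P' F)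

end Basic

/-! ### Adornments and the language extended by magic predicates -/

/-- An adornment of `p`: `true` marks a bound position, `false` a free one. -/
abbrev Adornment {Pr : Type*} (Pos : Pr → Type*) (p : Pr) := Pos p → Bool

/-- The original predicates together with a new predicate `magic_p^α` for each adorned `p^α`. -/
inductive MPred {Pr : Type*} (Pos : Pr → Type*) where
  | orig (p : Pr) : MPred Pos
  | magic (p : Pr) (α : Adornment Pos p) : MPred Pos

/-- Positions in the extended language; `magic_p^α` keeps exactly the bound positions of `p`. -/
def MPos {Pr : Type*} (Pos : Pr → Type*) : MPred Pos → Type _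
  | .orig p => Pos p
  | .magic p α => {i : Pos p // α i = true}

section Magic

variable {Pr : Type*} {Pos : Pr → Type*} {T V C : Type*}

/-- An atom viewed in the extended language. -/
def Atom.lift (a : Atom Pos T) : Atom (MPos Pos) T := ⟨.orig a.pred, a.args⟩

open scoped Classical in
/-- A rule viewed in the extended language. -/
noncomputable def Rule.lift (r : Rule Pos T) : Rule (MPos Pos) T where
  head := r.head.image Atom.lift
  pos := r.pos.image Atom.lift
  neg := r.neg.image Atom.lift
  head_nonempty := r.head_nonempty.image _

/-- A program viewed in the extended language, where the magic predicates are further predicate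
symbols that do not occur in it. -/
def liftProgram (P : Program Pos V C) : Program (MPos Pos) V C := Rule.lift '' P

/-- The magic version of the adorned atom `p^α(t)`: drop the free arguments. -/
def Atom.magic (a : Atom Pos T) (α : Adornment Pos a.pred) : Atom (MPos Pos) T :=
  ⟨.magic a.pred α, fun i => a.args i.1⟩

/-- A SIPS for a rule `r` with respect to a binding `α` for its head atom `a`: a strict partial order
on the atoms of `r` in which `a` precedes every other atom and no other head atom and no other
negated body atom precedes anything, and a set of variables of `b` for each atom `b` of `r`. -/
structure SIPS (r : Rule Pos (Term V C)) (a : Atom Pos (Term V C))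
    (α : Adornment Pos a.pred) where
  prec : Atom Pos (Term V C) → Atom Pos (Term V C) → Prop
  prec_mem : ∀ b c, prec b c → b ∈ r.atoms ∧ c ∈ r.atoms
  prec_irrefl : ∀ b, ¬ prec b b
  prec_trans : ∀ b c d, prec b c → prec c d → prec b d
  head_prec : ∀ b ∈ r.atoms, b ≠ a → prec a b
  not_prec : ∀ b c, b ≠ a → (b ∈ r.head ∨ b ∈ r.neg) → ¬ prec b c
  bnd : Atom Pos (Term V C) → Set V
  bnd_subset : ∀ b ∈ r.atoms, bnd b ⊆ b.vars

/-- A fixed choice of a SIPS for every rule, every atom of its head and every binding. -/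
abbrev SIPSChoice {Pr : Type*} (Pos : Pr → Type*) (V C : Type*) :=
  ∀ (r : Rule Pos (Term V C)) (a : Atom Pos (Term V C)) (_ : a ∈ r.head)
    (α : Adornment Pos a.pred), SIPS r a α

/-- The variable `x` of the atom `b` of `r` is bound: it is bound by the head atom `a`, or
by a positive body atom preceding `b`. -/
def SIPS.VarBound {r : Rule Pos (Term V C)} {a : Atom Pos (Term V C)} {α : Adornment Pos a.pred}
    (s : SIPS r a α) (b : Atom Pos (Term V C)) (x : V) : Prop :=
  x ∈ s.bnd a ∨ ∃ c ∈ r.pos, s.prec c b ∧ x ∈ s.bnd c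

/-- An argument of `b` is bound if it is a constant or a bound variable. -/
def SIPS.TermBound {r : Rule Pos (Term V C)} {a : Atom Pos (Term V C)} {α : Adornment Pos a.pred}
    (s : SIPS r a α) (b : Atom Pos (Term V C)) : Term V C → Prop
  | .var x => s.VarBound b x
  | .const _ => True

open scoped Classical in
/-- The adornment that the SIPS gives to an atom `b` of `r` other than the head atom `a`. -/
noncomputable def SIPS.adorn {r : Rule Pos (Term V C)} {a : Atom Pos (Term V C)}
    {α : Adornment Pos a.pred} (s : SIPS r a α) (b : Atom Pos (Term V C)) :
    Adornment Pos b.pred :=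
  fun i => decide (s.TermBound b (b.args i))

/-- The adornment of a query atom: its constants are bound, its variables free. -/
def queryAdornment (Q : Atom Pos (Term V C)) : Adornment Pos Q.pred :=
  fun i => match Q.args i with
    | .var _ => false
    | .const _ => true

/-- The atoms of `r` that receive an adornment when `r` is adorned for its head atom `a`: the
other head atoms and all body atoms, as far as their predicate is an IDB predicate of `P`. -/
def AdornedAtom (P : Program Pos V C) (r : Rule Pos (Term V C)) (a b : Atom Pos (Term V C)) :
    Prop :=
  ((b ∈ r.head ∧ b ≠ a) ∨ b ∈ r.pos ∨ b ∈ r.neg) ∧ ¬ IsEDB P b.pred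

/-- The adorned predicates `p^α` that enter the work set `S` in a run of the algorithm: the one of
the query, and those that occur when a rule is adorned for an adorned predicate taken from `S`. -/
inductive Reached (σ : SIPSChoice Pos V C) (Q : Atom Pos (Term V C)) (P : Program Pos V C) :
    (p : Pr) → Adornment Pos p → Prop
  | query : Reached σ Q P Q.pred (queryAdornment Q)
  | adorn (r : Rule Pos (Term V C)) (hr : r ∈ P) (a : Atom Pos (Term V C)) (ha : a ∈ r.head)
      (α : Adornment Pos a.pred) (hα : Reached σ Q P a.pred α)
      (b : Atom Pos (Term V C)) (hb : AdornedAtom P r a b) :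
      Reached σ Q P b.pred ((σ r a ha α).adorn b)

/-- The magic seed. -/
def seedRule (Q : Atom Pos (Term V C)) : Rule (MPos Pos) (Term V C) where
  head := {Q.magic (queryAdornment Q)}
  pos := ∅
  neg := ∅
  head_nonempty := Finset.singleton_nonempty _

open scoped Classical in
/-- The magic rule for the adorned atom `b` of `r`.  Its body consists of the magic version of
the head atom `a` and of the atoms other than `a` that precede `b`. -/
noncomputable def magicRule {r : Rule Pos (Term V C)} {a : Atom Pos (Term V C)}
    {α : Adornment Pos a.pred} (s : SIPS r a α) (b : Atom Pos (Term V C)) :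
    Rule (MPos Pos) (Term V C) where
  head := {b.magic (s.adorn b)}
  pos := {a.magic α} ∪ (r.atoms.filter (fun c => s.prec c b ∧ c ≠ a)).image Atom.lift
  neg := ∅
  head_nonempty := Finset.singleton_nonempty _

open scoped Classical in
/-- The modified rule: `r` with the magic versions of all its adorned head atoms added to the
positive body. -/
noncomputable def modifiedRule {r : Rule Pos (Term V C)} {a : Atom Pos (Term V C)}
    {α : Adornment Pos a.pred} (s : SIPS r a α) : Rule (MPos Pos) (Term V C) where
  head := r.head.image Atom.lift
  pos := {a.magic α} ∪ (r.head.erase a).image (fun b => b.magic (s.adorn b)) ∪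
    r.pos.image Atom.lift
  neg := r.neg.image Atom.lift
  head_nonempty := r.head_nonempty.image _

/-- The rewritten program: magic seed, magic rules, modified rules, and the EDB part of `P`. -/
def DMS (σ : SIPSChoice Pos V C) (Q : Atom Pos (Term V C)) (P : Program Pos V C) :
    Program (MPos Pos) V C :=
  {seedRule Q} ∪
  {m | ∃ r ∈ P, ∃ a, ∃ ha : a ∈ r.head, ∃ α, Reached σ Q P a.pred α ∧
    ∃ b, AdornedAtom P r a b ∧ m = magicRule (σ r a ha α) b} ∪
  {m | ∃ r ∈ P, ∃ a, ∃ ha : a ∈ r.head, ∃ α, Reached σ Q P a.pred α ∧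
    m = modifiedRule (σ r a ha α)} ∪
  liftProgram (EDB P)

end Magic

end ASP

/-!
The rewritten program decides exactly the atoms that its magic atoms mark as relevant.  Let `N` be a
model of (a reduct of) the rewritten program.  Call a ground atom relevant if its predicate is an EDB
predicate or `N` contains one of its magic versions for a reached adornment.  The magic rules make
the relevant atoms nearly a splitting set: if a head atom of a rule instance is relevant, then
either some relevant positive body atom of the instance is false in `N` (take a false one that is
minimal in the SIPS), or the whole positive body is true and all IDB atoms of the instance are
relevant (`IsMagicModel.relevant_cases`, `IsMagicModel.magic_mem`).  Hence the relevant atoms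
outside `N` form an unfounded set of the original program: removing them from a model that extends
`N` leaves a model, so no answer set extending `N` contains any of them
(`IsMagicModel.mem_of_relevant`).  Every instance of the query is relevant because of the seed.

Given an answer set `N` of `DMS(Q,P) ∪ F`, super-consistency yields an answer set `M` of `P ∪ F`
with the original atoms of `N` added as facts.  By the above, `M` adds no relevant atoms to `N`, and
the minimality of `N` shows that the added facts are redundant, so `M` is an answer set of
`P ∪ F`.  Conversely, an answer set `M` of `P ∪ F` yields the magic atoms derivable when body
atoms are evaluated in `M`; together with the relevant part of `M` they are an answer set of
`DMS(Q,P) ∪ F`, whose minimality is again `IsMagicModel.mem_of_relevant`, applied to a smaller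
model.  Both constructions preserve the truth of all instances of the query, which gives both
equivalences.

If `P` is safe, the rewritten program may have a different universe.  Atoms of reached predicates
with an argument outside that universe are therefore counted as relevant too; safety traces such an
argument of a head atom back to a positive body atom.
-/

namespace ASP

/-! ### Instances, universes and bases of programs -/

section Instances

variable {Pr : Type*} {Pos : Pr → Type*} {V C : Type*}

/-- The ground instance of an atom under a substitution. -/
abbrev Atom.inst (a : Atom Pos (Term V C)) (θ : V → C) : Atom Pos C := a.map (Term.subst θ)

lemma Atom.inst_args_mem {a : Atom Pos (Term V C)} {θ : V → C} {U : Set C}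
    (hv : ∀ x ∈ a.vars, θ x ∈ U) (hc : ∀ c ∈ a.consts, c ∈ U) (i : Pos a.pred) :
    (a.inst θ).args i ∈ U := by
  change Term.subst θ (a.args i) ∈ U
  cases h : a.args i with
  | var x => exact hv x ⟨i, h⟩
  | const c => exact hc c ⟨i, h⟩

lemma Atom.subst_mem_of_inst_args_mem {a : Atom Pos (Term V C)} {θ : V → C} {U : Set C}
    (h : ∀ i, (a.inst θ).args i ∈ U) {x : V} (hx : x ∈ a.vars) : θ x ∈ U := by
  obtain ⟨i, hi⟩ := hx
  have := h i
  change Term.subst θ (a.args i) ∈ U at this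
  rwa [hi] at this

lemma Rule.IsFact.not_mem_vars {r : Rule Pos (Term V C)} (h : r.IsFact) (x : V) :
    x ∉ r.vars := by
  classical
  rintro ⟨a, ha, hx⟩
  obtain ⟨h1, h2, -, h4⟩ := h
  simp only [Rule.atoms, h1, h2, Finset.union_empty] at ha
  rw [h4 a ha] at hx
  exact hx

lemma Rule.mem_atoms {r : Rule Pos (Term V C)} {a : Atom Pos (Term V C)} :
    a ∈ r.atoms ↔ a ∈ r.head ∨ a ∈ r.pos ∨ a ∈ r.neg := by
  classical
  simp [Rule.atoms]

/-- The models of the reduct of a grounding, in terms of rule instances. -/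
lemma models_reduct_ground_iff [Inhabited C] {P : Program Pos V C} {I J : Set (Atom Pos C)} :
    Models (reduct (ground P) I) J ↔
      ∀ r ∈ P, ∀ θ : V → C, (∀ x ∈ r.vars, θ x ∈ programUniverse P) →
        (∀ a ∈ r.neg, a.inst θ ∉ I) → (∀ a ∈ r.pos, a.inst θ ∈ J) →
        ∃ a ∈ r.head, a.inst θ ∈ J := by
  classical
  constructor
  · intro h r hr θ hθ hneg hpos
    have := h ⟨(r.map (Term.subst θ)).head, (r.map (Term.subst θ)).pos, ∅,
      (r.map (Term.subst θ)).head_nonempty⟩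
      ⟨r.map (Term.subst θ), ⟨r, hr, θ, hθ, rfl⟩, by simpa [Rule.map] using hneg, rfl⟩
      ⟨by simpa [Rule.map] using hpos, by simp⟩
    simpa [Rule.map] using this
  · rintro h s' ⟨s, ⟨r, hr, θ, hθ, rfl⟩, hneg, rfl⟩ ⟨hpos, -⟩
    have := h r hr θ hθ (by simpa [Rule.map] using hneg) (by simpa [Rule.map] using hpos)
    simpa [Rule.map] using this

lemma mem_programUniverse_of_mem_consts [Inhabited C] {P : Program Pos V C}
    {r : Rule Pos (Term V C)} (hr : r ∈ P) {a : Atom Pos (Term V C)} (ha : a ∈ r.atoms) {c : C}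
    (hc : c ∈ a.consts) : c ∈ programUniverse P :=
  Or.inl ⟨r, hr, a, ha, hc⟩

/-- Minimality already confines an answer set to the base: the part of a model that lies in the base
is again a model. -/
lemma mem_answerSets_iff [Inhabited C] {P : Program Pos V C} {M : Set (Atom Pos C)} :
    M ∈ answerSets P ↔ Minimal (Models (reduct (ground P) M)) M := by
  refine ⟨fun h => h.2, fun h => ⟨?_, h⟩⟩
  have hM := models_reduct_ground_iff.1 h.prop
  have hmod : Models (reduct (ground P) M) (M ∩ programBase P) := by
    refine models_reduct_ground_iff.2 fun r hr θ hθ hneg hpos => ?_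
    obtain ⟨a, ha, haM⟩ := hM r hr θ hθ hneg fun a ha => (hpos a ha).1
    have hat : a ∈ r.atoms := Rule.mem_atoms.2 (Or.inl ha)
    exact ⟨a, ha, haM, ⟨r, hr, a, hat, rfl⟩, Atom.inst_args_mem
      (fun x hx => hθ x ⟨a, hat, hx⟩) fun c hc => mem_programUniverse_of_mem_consts hr hat hc⟩
  exact fun A hA => (h.le_of_le hmod Set.inter_subset_left hA).2

lemma programConsts_withFacts {P : Program Pos V C} {F : Set (Atom Pos C)} :
    programConsts (withFacts P F) = programConsts P ∪ {c | ∃ A ∈ F, ∃ i, A.args i = c} := by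
  classical
  ext c
  constructor
  · rintro ⟨r, hr | ⟨A, hA, rfl⟩, a, ha, hc⟩
    · exact Or.inl ⟨r, hr, a, ha, hc⟩
    · simp only [Rule.mem_atoms, factRule, Finset.mem_singleton, Finset.notMem_empty,
        or_false] at ha
      subst ha
      obtain ⟨i, hi⟩ := hc
      exact Or.inr ⟨A, hA, i, Term.const.inj hi⟩
  · rintro (⟨r, hr, a, ha, hc⟩ | ⟨A, hA, i, rfl⟩)
    · exact ⟨r, Or.inl hr, a, ha, hc⟩
    · exact ⟨_, Or.inr ⟨A, hA, rfl⟩, A.map Term.const,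
        Rule.mem_atoms.2 (Or.inl (Finset.mem_singleton_self _)), i, rfl⟩

lemma args_mem_programUniverse_withFacts [Inhabited C] (P : Program Pos V C)
    {F : Set (Atom Pos C)} {A : Atom Pos C} (hA : A ∈ F) (i : Pos A.pred) :
    A.args i ∈ programUniverse (withFacts P F) :=
  Or.inl (by rw [programConsts_withFacts]; exact Or.inr ⟨A, hA, i, rfl⟩)

lemma programUniverse_congr [Inhabited C] {Pr' : Type*} {Pos' : Pr' → Type*}
    {P : Program Pos V C} {P' : Program Pos' V C} (h : programConsts P = programConsts P') :
    programUniverse P = programUniverse P' := by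
  unfold programUniverse; rw [h]

/-- Facts over the universe of a program do not change its universe. -/
lemma programUniverse_withFacts_union [Inhabited C] {P : Program Pos V C}
    {F E : Set (Atom Pos C)} (hE : ∀ A ∈ E, ∀ i, A.args i ∈ programUniverse (withFacts P F)) :
    programUniverse (withFacts P (F ∪ E)) = programUniverse (withFacts P F) := by
  have h1 : programConsts (withFacts P (F ∪ E)) =
      programConsts (withFacts P F) ∪ {c | ∃ A ∈ E, ∃ i, A.args i = c} := by
    simp only [programConsts_withFacts, Set.union_assoc]
    congr 1
    ext c
    simp only [Set.mem_union, Set.mem_ofPred_eq, or_and_right, exists_or]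
  by_cases h0 : programConsts (withFacts P F) = ∅
  · have hU : programUniverse (withFacts P F) = {default} := by
      ext c; simp [programUniverse, h0]
    rw [hU]
    ext c
    simp only [programUniverse, h1, h0, Set.empty_union, Set.mem_ofPred_eq, Set.mem_singleton_iff]
    constructor
    · rintro (⟨A, hA, i, rfl⟩ | ⟨-, rfl⟩)
      · simpa [hU] using hE A hA i
      · rfl
    · rintro rfl
      by_cases hne : {c : C | ∃ A ∈ E, ∃ i, A.args i = c} = ∅
      · exact Or.inr ⟨hne, rfl⟩
      · obtain ⟨c, A, hA, i, rfl⟩ := Set.nonempty_iff_ne_empty.2 hne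
        exact Or.inl ⟨A, hA, i, by simpa [hU] using hE A hA i⟩
  · have h2 : programConsts (withFacts P (F ∪ E)) = programConsts (withFacts P F) := by
      rw [h1, Set.union_eq_left]
      rintro c ⟨A, hA, i, rfl⟩
      exact (hE A hA i).resolve_right fun h => h0 h.1
    exact programUniverse_congr h2

lemma finite_programBase [Inhabited C] [∀ p, Finite (Pos p)] {P : Program Pos V C}
    (hP : P.Finite) : (programBase P).Finite := by
  classical
  have hat : {a : Atom Pos (Term V C) | ∃ r ∈ P, a ∈ r.atoms}.Finite := by
    have : {a : Atom Pos (Term V C) | ∃ r ∈ P, a ∈ r.atoms} = ⋃ r ∈ P, (r.atoms : Set _) := by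
      ext; simp
    rw [this]
    exact hP.biUnion fun r _ => r.atoms.finite_toSet
  have hC : (programConsts P).Finite := by
    have : programConsts P ⊆ ⋃ a ∈ {a : Atom Pos (Term V C) | ∃ r ∈ P, a ∈ r.atoms},
        Set.range fun i => Term.subst (fun _ => default) (a.args i) := by
      rintro c ⟨r, hr, a, ha, i, hi⟩
      simp only [Set.mem_iUnion]
      exact ⟨a, ⟨r, hr, ha⟩, i, by simp [hi, Term.subst]⟩
    exact (hat.biUnion fun a _ => Set.finite_range _).subset this
  have hU : (programUniverse P).Finite := by
    refine (hC.union (Set.finite_singleton default)).subset ?_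
    rintro c (h | h)
    · exact Or.inl h
    · exact Or.inr h.2
  have : programBase P ⊆ ⋃ a ∈ {a : Atom Pos (Term V C) | ∃ r ∈ P, a ∈ r.atoms},
      (fun f : Pos a.pred → C => (⟨a.pred, f⟩ : Atom Pos C)) ''
        (Set.univ.pi fun _ => programUniverse P) := by
    rintro ⟨p, f⟩ ⟨⟨r, hr, a, ha, rfl⟩, hf⟩
    simp only [Set.mem_iUnion]
    exact ⟨a, ⟨r, hr, ha⟩, f, fun i _ => hf i, rfl⟩
  exact (hat.biUnion fun a _ => (Set.Finite.pi' fun _ => hU).image _ |>.subset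
    (by rintro _ ⟨f, hf, rfl⟩; exact ⟨f, fun i => hf i trivial, rfl⟩)).subset this

lemma not_isEDB_of_mem_head {P : Program Pos V C} {r : Rule Pos (Term V C)} (hr : r ∈ P)
    {a : Atom Pos (Term V C)} (ha : a ∈ r.head) (h : ¬ r.IsFact) : ¬ IsEDB P a.pred :=
  fun hE => h (hE r hr ⟨a, ha, rfl⟩)

lemma isFact_of_mem_EDB {P : Program Pos V C} {r : Rule Pos (Term V C)} (hr : r ∈ EDB P) :
    r.IsFact := by
  obtain ⟨a, ha⟩ := r.head_nonempty
  exact hr.2 a ha r hr.1 ⟨a, ha, rfl⟩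

/-- A fact whose predicate is an EDB predicate belongs to the EDB part. -/
lemma mem_EDB_of_isEDB {P : Program Pos V C} {r : Rule Pos (Term V C)} (hr : r ∈ P)
    {a : Atom Pos (Term V C)} (ha : a ∈ r.head) (h : IsEDB P a.pred) : r ∈ EDB P := by
  refine ⟨hr, fun b hb => ?_⟩
  obtain ⟨-, -, h1, -⟩ := h r hr ⟨a, ha, rfl⟩
  rwa [Finset.card_le_one.1 h1.le b hb a ha]

end Instances

/-! ### Models of the reducts of the original and the rewritten program -/

section Models

variable {Pr : Type*} {Pos : Pr → Type*} {V C : Type*}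

/-- `J` is a model of the reduct with respect to `I` of the program `P ∪ F`, read in the extended
language and instantiated over `U`. -/
def IsLiftModel (P : Program Pos V C) (U : Set C) (F I J : Set (Atom (MPos Pos) C)) : Prop :=
  F ⊆ J ∧ ∀ r ∈ P, ∀ θ : V → C, (∀ x ∈ r.vars, θ x ∈ U) →
    (∀ a ∈ r.neg, (a.inst θ).lift ∉ I) → (∀ a ∈ r.pos, (a.inst θ).lift ∈ J) →
    ∃ a ∈ r.head, (a.inst θ).lift ∈ J

/-- `J` is a model of the reduct with respect to `I` of the program `DMS σ Q P ∪ F`, instantiated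
over `U`. -/
structure IsMagicModel (σ : SIPSChoice Pos V C) (Q : Atom Pos (Term V C)) (P : Program Pos V C)
    (U : Set C) (F I J : Set (Atom (MPos Pos) C)) : Prop where
  facts : F ⊆ J
  seed : ∀ θ : V → C, (Q.inst θ).magic (queryAdornment Q) ∈ J
  magic : ∀ r ∈ P, ∀ a, ∀ ha : a ∈ r.head, ∀ α, Reached σ Q P a.pred α →
    ∀ b, AdornedAtom P r a b → ∀ θ : V → C,
    (∀ x ∈ (magicRule (σ r a ha α) b).vars, θ x ∈ U) → (a.inst θ).magic α ∈ J →
    (∀ c ∈ r.atoms, (σ r a ha α).prec c b → c ≠ a → (c.inst θ).lift ∈ J) →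
    (b.inst θ).magic ((σ r a ha α).adorn b) ∈ J
  modified : ∀ r ∈ P, ∀ a, ∀ ha : a ∈ r.head, ∀ α, Reached σ Q P a.pred α → ∀ θ : V → C,
    (∀ x ∈ r.vars, θ x ∈ U) → (∀ b ∈ r.neg, (b.inst θ).lift ∉ I) → (a.inst θ).magic α ∈ J →
    (∀ b ∈ r.head, b ≠ a → (b.inst θ).magic ((σ r a ha α).adorn b) ∈ J) →
    (∀ b ∈ r.pos, (b.inst θ).lift ∈ J) → ∃ b ∈ r.head, (b.inst θ).lift ∈ J
  edb : ∀ r ∈ EDB P, ∀ a ∈ r.head, ∀ θ : V → C, (a.inst θ).lift ∈ J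

lemma Rule.vars_lift (r : Rule Pos (Term V C)) : r.lift.vars = r.vars := by
  classical
  ext x
  constructor
  · rintro ⟨a, ha, hx⟩
    rw [Rule.mem_atoms] at ha
    simp only [Rule.lift, Finset.mem_image] at ha
    rcases ha with ⟨b, hb, rfl⟩ | ⟨b, hb, rfl⟩ | ⟨b, hb, rfl⟩
    · exact ⟨b, Rule.mem_atoms.2 (Or.inl hb), hx⟩
    · exact ⟨b, Rule.mem_atoms.2 (Or.inr (Or.inl hb)), hx⟩
    · exact ⟨b, Rule.mem_atoms.2 (Or.inr (Or.inr hb)), hx⟩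
  · rintro ⟨a, ha, hx⟩
    refine ⟨a.lift, ?_, hx⟩
    rw [Rule.mem_atoms] at ha ⊢
    simp only [Rule.lift]
    rcases ha with h | h | h
    · exact Or.inl (Finset.mem_image_of_mem _ h)
    · exact Or.inr (Or.inl (Finset.mem_image_of_mem _ h))
    · exact Or.inr (Or.inr (Finset.mem_image_of_mem _ h))

lemma mem_lift_atoms {r : Rule Pos (Term V C)} {a : Atom Pos (Term V C)} (ha : a ∈ r.atoms) :
    a.lift ∈ r.lift.atoms := by
  classical
  rw [Rule.mem_atoms] at ha ⊢
  simp only [Rule.lift]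
  rcases ha with h | h | h
  · exact Or.inl (Finset.mem_image_of_mem _ h)
  · exact Or.inr (Or.inl (Finset.mem_image_of_mem _ h))
  · exact Or.inr (Or.inr (Finset.mem_image_of_mem _ h))

lemma exists_of_mem_modifiedRule_atoms {r : Rule Pos (Term V C)} {a : Atom Pos (Term V C)}
    (ha : a ∈ r.head) {α : Adornment Pos a.pred} {s : SIPS r a α}
    {b : Atom (MPos Pos) (Term V C)} (hb : b ∈ (modifiedRule s).atoms) :
    ∃ b' ∈ r.atoms, b.vars ⊆ b'.vars ∧ b.consts ⊆ b'.consts := by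
  classical
  rw [Rule.mem_atoms] at hb
  simp only [modifiedRule, Finset.mem_image, Finset.mem_union, Finset.mem_singleton,
    Finset.mem_erase] at hb
  rcases hb with ⟨b, hb, rfl⟩ | ((rfl | ⟨b, hb, rfl⟩) | ⟨b, hb, rfl⟩) | ⟨b, hb, rfl⟩
  · exact ⟨b, Rule.mem_atoms.2 (Or.inl hb), subset_rfl, subset_rfl⟩
  · exact ⟨a, Rule.mem_atoms.2 (Or.inl ha), fun x ⟨i, hi⟩ => ⟨i.1, hi⟩, fun x ⟨i, hi⟩ => ⟨i.1, hi⟩⟩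
  · exact ⟨b, Rule.mem_atoms.2 (Or.inl hb.2), fun x ⟨i, hi⟩ => ⟨i.1, hi⟩,
      fun x ⟨i, hi⟩ => ⟨i.1, hi⟩⟩
  · exact ⟨b, Rule.mem_atoms.2 (Or.inr (Or.inl hb)), subset_rfl, subset_rfl⟩
  · exact ⟨b, Rule.mem_atoms.2 (Or.inr (Or.inr hb)), subset_rfl, subset_rfl⟩

lemma lift_mem_modifiedRule_atoms {r : Rule Pos (Term V C)} {a b : Atom Pos (Term V C)}
    {α : Adornment Pos a.pred} (s : SIPS r a α) (hb : b ∈ r.atoms) :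
    b.lift ∈ (modifiedRule s).atoms := by
  classical
  rw [Rule.mem_atoms] at hb ⊢
  simp only [modifiedRule]
  rcases hb with h | h | h
  · exact Or.inl (Finset.mem_image_of_mem _ h)
  · exact Or.inr (Or.inl (Finset.mem_union_right _ (Finset.mem_image_of_mem _ h)))
  · exact Or.inr (Or.inr (Finset.mem_image_of_mem _ h))

lemma exists_of_mem_magicRule_atoms {P : Program Pos V C} {r : Rule Pos (Term V C)}
    {a b : Atom Pos (Term V C)} (ha : a ∈ r.head) {α : Adornment Pos a.pred} {s : SIPS r a α}
    (hb : AdornedAtom P r a b)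
    {c : Atom (MPos Pos) (Term V C)} (hc : c ∈ (magicRule s b).atoms) :
    ∃ c' ∈ r.atoms, c.vars ⊆ c'.vars ∧ c.consts ⊆ c'.consts := by
  classical
  rw [Rule.mem_atoms] at hc
  simp only [magicRule, Finset.mem_image, Finset.mem_union, Finset.mem_singleton,
    Finset.mem_filter, Finset.notMem_empty, or_false] at hc
  rcases hc with rfl | rfl | ⟨c, hc, rfl⟩
  · refine ⟨b, ?_, fun x ⟨i, hi⟩ => ⟨i.1, hi⟩, fun x ⟨i, hi⟩ => ⟨i.1, hi⟩⟩
    rcases hb.1 with h | h | h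
    · exact Rule.mem_atoms.2 (Or.inl h.1)
    · exact Rule.mem_atoms.2 (Or.inr (Or.inl h))
    · exact Rule.mem_atoms.2 (Or.inr (Or.inr h))
  · exact ⟨a, Rule.mem_atoms.2 (Or.inl ha), fun x ⟨i, hi⟩ => ⟨i.1, hi⟩, fun x ⟨i, hi⟩ => ⟨i.1, hi⟩⟩
  · exact ⟨c, hc.1, subset_rfl, subset_rfl⟩

lemma vars_modifiedRule {r : Rule Pos (Term V C)} {a : Atom Pos (Term V C)} (ha : a ∈ r.head)
    {α : Adornment Pos a.pred} (s : SIPS r a α) : (modifiedRule s).vars = r.vars := by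
  ext x
  constructor
  · rintro ⟨b, hb, hx⟩
    obtain ⟨b', hb', h, -⟩ := exists_of_mem_modifiedRule_atoms ha hb
    exact ⟨b', hb', h hx⟩
  · rintro ⟨b, hb, hx⟩
    exact ⟨b.lift, lift_mem_modifiedRule_atoms s hb, hx⟩

lemma vars_magicRule_subset {P : Program Pos V C} {r : Rule Pos (Term V C)}
    {a b : Atom Pos (Term V C)} (ha : a ∈ r.head) {α : Adornment Pos a.pred} (s : SIPS r a α)
    (hb : AdornedAtom P r a b) : (magicRule s b).vars ⊆ r.vars := by
  rintro x ⟨c, hc, hx⟩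
  obtain ⟨c', hc', h, -⟩ := exists_of_mem_magicRule_atoms ha hb hc
  exact ⟨c', hc', h hx⟩

lemma seedRule_vars (Q : Atom Pos (Term V C)) (x : V) : x ∉ (seedRule Q).vars := by
  classical
  rintro ⟨a, ha, hx⟩
  simp only [Rule.mem_atoms, seedRule, Finset.mem_singleton, Finset.notMem_empty, or_false] at ha
  subst ha
  obtain ⟨⟨i, hi⟩, hx⟩ := hx
  simp only [queryAdornment] at hi
  change Q.args i = _ at hx
  simp [hx] at hi

lemma factRule_vars (A : Atom Pos C) (x : V) : x ∉ (factRule A : Rule Pos (Term V C)).vars := by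
  classical
  rintro ⟨a, ha, i, hi⟩
  simp only [Rule.mem_atoms, factRule, Finset.mem_singleton, Finset.notMem_empty, or_false] at ha
  subst ha
  simp [Atom.map] at hi

variable [Inhabited C]

lemma models_reduct_ground_withFacts_iff {P : Program Pos V C} {F I J : Set (Atom Pos C)} :
    Models (reduct (ground (withFacts P F)) I) J ↔
      F ⊆ J ∧ ∀ r ∈ P, ∀ θ : V → C,
        (∀ x ∈ r.vars, θ x ∈ programUniverse (withFacts P F)) →
        (∀ a ∈ r.neg, a.inst θ ∉ I) → (∀ a ∈ r.pos, a.inst θ ∈ J) →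
        ∃ a ∈ r.head, a.inst θ ∈ J := by
  rw [models_reduct_ground_iff]
  constructor
  · refine fun h => ⟨fun A hA => ?_, fun r hr => h r (Or.inl hr)⟩
    have := h (factRule A) (Or.inr ⟨A, hA, rfl⟩) (fun _ => default)
      (fun x hx => (factRule_vars A x hx).elim) (by simp [factRule]) (by simp [factRule])
    obtain ⟨a, ha, haJ⟩ := this
    simp only [factRule, Finset.mem_singleton] at ha
    subst ha
    exact haJ
  · rintro ⟨hF, h⟩ r (hr | ⟨A, hA, rfl⟩)
    · exact h r hr
    · exact fun θ _ _ _ => ⟨A.map Term.const, Finset.mem_singleton_self _, hF hA⟩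

lemma models_liftProgram_iff {P : Program Pos V C} {F I J : Set (Atom (MPos Pos) C)} :
    Models (reduct (ground (withFacts (liftProgram P) F)) I) J ↔
      IsLiftModel P (programUniverse (withFacts (liftProgram P) F)) F I J := by
  classical
  rw [models_reduct_ground_withFacts_iff, IsLiftModel]
  refine and_congr_right fun _ => ?_
  rw [liftProgram, Set.forall_mem_image]
  refine forall₂_congr fun r _ => forall_congr' fun θ => ?_
  rw [Rule.vars_lift]
  simp only [Rule.lift, Finset.forall_mem_image, Finset.exists_mem_image]
  rfl

lemma models_DMS_iff {σ : SIPSChoice Pos V C} {Q : Atom Pos (Term V C)} {P : Program Pos V C}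
    {F I J : Set (Atom (MPos Pos) C)} :
    Models (reduct (ground (withFacts (DMS σ Q P) F)) I) J ↔
      IsMagicModel σ Q P (programUniverse (withFacts (DMS σ Q P) F)) F I J := by
  classical
  rw [models_reduct_ground_withFacts_iff]
  constructor
  · rintro ⟨hF, h⟩
    refine ⟨hF, fun θ => ?_, ?_, ?_, ?_⟩
    · obtain ⟨a, ha, haJ⟩ := h (seedRule Q) (Or.inl (Or.inl (Or.inl rfl))) θ
        (fun x hx => (seedRule_vars Q x hx).elim) (by simp [seedRule]) (by simp [seedRule])
      simp only [seedRule, Finset.mem_singleton] at ha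
      subst ha
      exact haJ
    · intro r hr a ha α hα b hb θ hθ haJ hc
      obtain ⟨b', hb', hJ⟩ := h _ (Or.inl (Or.inl (Or.inr ⟨r, hr, a, ha, α, hα, b, hb, rfl⟩))) θ hθ
        (by simp [magicRule]) (by
          intro c hc'
          simp only [magicRule, Finset.mem_union, Finset.mem_singleton, Finset.mem_image,
            Finset.mem_filter] at hc'
          rcases hc' with rfl | ⟨c, ⟨h1, h2, h3⟩, rfl⟩
          · exact haJ
          · exact hc c h1 h2 h3)
      simp only [magicRule, Finset.mem_singleton] at hb'
      subst hb'
      exact hJ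
    · intro r hr a ha α hα θ hθ hneg haJ hhead hpos
      obtain ⟨b', hb', hJ⟩ := h _ (Or.inl (Or.inr ⟨r, hr, a, ha, α, hα, rfl⟩)) θ
        (by rwa [vars_modifiedRule ha]) (by
          intro c hc'
          simp only [modifiedRule, Finset.mem_image] at hc'
          obtain ⟨c, hc, rfl⟩ := hc'
          exact hneg c hc) (by
          intro c hc'
          simp only [modifiedRule, Finset.mem_union, Finset.mem_singleton, Finset.mem_image,
            Finset.mem_erase] at hc'
          rcases hc' with (rfl | ⟨c, ⟨h1, h2⟩, rfl⟩) | ⟨c, hc, rfl⟩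
          · exact haJ
          · exact hhead c h2 h1
          · exact hpos c hc)
      simp only [modifiedRule, Finset.mem_image] at hb'
      obtain ⟨b, hb, rfl⟩ := hb'
      exact ⟨b, hb, hJ⟩
    · intro r hr a ha θ
      have hfact := isFact_of_mem_EDB hr
      obtain ⟨b', hb', hJ⟩ := h _ (Or.inr ⟨r, hr, rfl⟩) θ
        (by rw [Rule.vars_lift]; exact fun x hx => (hfact.not_mem_vars x hx).elim)
        (by simp [Rule.lift, hfact.2.1]) (by simp [Rule.lift, hfact.1])
      simp only [Rule.lift, Finset.mem_image] at hb'
      obtain ⟨b, hb, rfl⟩ := hb'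
      rw [Finset.card_le_one.1 hfact.2.2.1.le a ha b hb]
      exact hJ
  · intro h
    refine ⟨h.facts, ?_⟩
    rintro _ (((rfl | ⟨r, hr, a, ha, α, hα, b, hb, rfl⟩) | ⟨r, hr, a, ha, α, hα, rfl⟩) |
      ⟨r, hr, rfl⟩) θ hθ hneg hpos
    · exact ⟨_, Finset.mem_singleton_self _, h.seed θ⟩
    · refine ⟨_, Finset.mem_singleton_self _, h.magic r hr a ha α hα b hb θ hθ
        (hpos _ (Finset.mem_union_left _ (Finset.mem_singleton_self _))) fun c h1 h2 h3 =>
        hpos _ (Finset.mem_union_right _ (Finset.mem_image_of_mem _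
          (Finset.mem_filter.2 ⟨h1, h2, h3⟩)))⟩
    · rw [vars_modifiedRule ha] at hθ
      obtain ⟨b, hb, hJ⟩ := h.modified r hr a ha α hα θ hθ
        (fun b hb => hneg _ (Finset.mem_image_of_mem _ hb))
        (hpos _ (Finset.mem_union_left _ (Finset.mem_union_left _ (Finset.mem_singleton_self _))))
        (fun b hb hba => hpos _ (Finset.mem_union_left _ (Finset.mem_union_right _
          (Finset.mem_image.2 ⟨b, Finset.mem_erase.2 ⟨hba, hb⟩, rfl⟩))))
        fun b hb => hpos _ (Finset.mem_union_right _ (Finset.mem_image_of_mem _ hb))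
      exact ⟨_, Finset.mem_image_of_mem _ hb, hJ⟩
    · obtain ⟨a, ha⟩ := r.head_nonempty
      exact ⟨_, Finset.mem_image_of_mem _ ha, h.edb r hr a ha θ⟩

end Models

/-! ### Relevant atoms -/

section Relevance

variable {Pr : Type*} {Pos : Pr → Type*} {V C : Type*}
  {σ : SIPSChoice Pos V C} {Q : Atom Pos (Term V C)} {P : Program Pos V C}
  {U U' : Set C} {F E I N M : Set (Atom (MPos Pos) C)}

variable (σ Q P U' N) in
/-- The ground atoms whose truth value the rewritten program determines, given the magic atoms in
`N`: those with an EDB predicate, those with a reached adornment whose magic version is in `N`, and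
those with a reached predicate and an argument outside the universe `U'` of the rewritten program.
Atoms of the last kind cannot be derived by either program; they matter only if `U'` is smaller
than the universe of the original program. -/
def Relevant (A : Atom Pos C) : Prop :=
  IsEDB P A.pred ∨
    ∃ α, Reached σ Q P A.pred α ∧ (A.magic α ∈ N ∨ ∃ i, A.args i ∉ U')

lemma Atom.lift_injective {T : Type*} :
    Function.Injective (Atom.lift : Atom Pos T → Atom (MPos Pos) T) := by
  rintro ⟨p, f⟩ ⟨q, g⟩ h
  injection h with h1 h2
  injection h1 with h1
  subst h1
  obtain rfl := eq_of_heq h2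
  rfl

lemma Atom.magic_ne_lift {T : Type*} (A : Atom Pos T) (α : Adornment Pos A.pred) (B : Atom Pos T) :
    A.magic α ≠ B.lift := by
  intro h
  injection h with h1
  injection h1

lemma SIPS.mem_pos_of_prec {r : Rule Pos (Term V C)} {a : Atom Pos (Term V C)}
    {α : Adornment Pos a.pred} (s : SIPS r a α) {b c : Atom Pos (Term V C)} (h : s.prec c b)
    (hc : c ≠ a) : c ∈ r.pos := by
  rcases Rule.mem_atoms.1 (s.prec_mem c b h).1 with h1 | h1 | h1
  · exact (s.not_prec c b hc (Or.inl h1) h).elim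
  · exact h1
  · exact (s.not_prec c b hc (Or.inr h1) h).elim

lemma AdornedAtom.mem_atoms {r : Rule Pos (Term V C)} {a b : Atom Pos (Term V C)}
    (h : AdornedAtom P r a b) : b ∈ r.atoms := by
  rcases h.1 with h | h | h
  · exact Rule.mem_atoms.2 (Or.inl h.1)
  · exact Rule.mem_atoms.2 (Or.inr (Or.inl h))
  · exact Rule.mem_atoms.2 (Or.inr (Or.inr h))

/-- If the positive body of a rule instance is true, the magic rules make all its adorned atoms
relevant. -/
lemma IsMagicModel.magic_mem (hN : IsMagicModel σ Q P U' F I N)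
    {r : Rule Pos (Term V C)} (hr : r ∈ P) {a : Atom Pos (Term V C)} (ha : a ∈ r.head)
    {α : Adornment Pos a.pred} (hα : Reached σ Q P a.pred α) {θ : V → C}
    (hθ : ∀ x ∈ r.vars, θ x ∈ U') (haN : (a.inst θ).magic α ∈ N)
    (hpos : ∀ c ∈ r.pos, (c.inst θ).lift ∈ N) {b : Atom Pos (Term V C)}
    (hb : AdornedAtom P r a b) : (b.inst θ).magic ((σ r a ha α).adorn b) ∈ N :=
  hN.magic r hr a ha α hα b hb θ (fun x hx => hθ x (vars_magicRule_subset ha _ hb hx)) haN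
    fun c _ hc hca => hpos c ((σ r a ha α).mem_pos_of_prec hc hca)

/-- A false positive body atom of a relevant rule instance is witnessed by a relevant one: one that
is minimal with respect to the SIPS. -/
lemma IsMagicModel.exists_relevant_false (hN : IsMagicModel σ Q P U' F I N)
    {r : Rule Pos (Term V C)} (hr : r ∈ P) {a : Atom Pos (Term V C)} (ha : a ∈ r.head)
    {α : Adornment Pos a.pred} (hα : Reached σ Q P a.pred α) {θ : V → C}
    (hθ : ∀ x ∈ r.vars, θ x ∈ U') (haN : (a.inst θ).magic α ∈ N)
    {c : Atom Pos (Term V C)} (hc : c ∈ r.pos) (hcN : (c.inst θ).lift ∉ N) :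
    ∃ c ∈ r.pos, (c.inst θ).lift ∉ N ∧ Relevant σ Q P U' N (c.inst θ) := by
  let s := σ r a ha α
  have : IsStrictOrder _ s.prec := { irrefl := s.prec_irrefl, trans := s.prec_trans }
  revert hcN
  refine Set.WellFoundedOn.induction
      (P := fun c => (c.inst θ).lift ∉ N →
        ∃ c ∈ r.pos, (c.inst θ).lift ∉ N ∧ Relevant σ Q P U' N (c.inst θ))
    (Finset.wellFoundedOn (r := s.prec) r.pos) hc ?_
  intro c hc ih hcN
  by_cases hlow : ∃ c' ∈ r.pos, s.prec c' c ∧ (c'.inst θ).lift ∉ N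
  · obtain ⟨c', hc', hlt, hcN'⟩ := hlow
    exact ih c' hc' hlt hcN'
  · push Not at hlow
    refine ⟨c, hc, hcN, ?_⟩
    by_cases hE : IsEDB P c.pred
    · exact Or.inl hE
    · have hb : AdornedAtom P r a c := ⟨Or.inr (Or.inl hc), hE⟩
      exact Or.inr ⟨s.adorn c, .adorn r hr a ha α hα c hb, Or.inl
        (hN.magic r hr a ha α hα c hb θ (fun x hx => hθ x (vars_magicRule_subset ha _ hb hx)) haN
          fun c' _ hlt hca => hlow c' (s.mem_pos_of_prec hlt hca) hlt)⟩

/-- A rule instance over `U'` lies over `U` if its positive body does: by safety, unless the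
universes agree anyway. -/
lemma subst_mem_of_safe (hsafe : SafeProgram P ∨ U = U')
    {r : Rule Pos (Term V C)} (hr : r ∈ P) {θ : V → C} (hθ : ∀ x ∈ r.vars, θ x ∈ U')
    (hpos : ∀ c ∈ r.pos, ∀ i, (c.inst θ).args i ∈ U) : ∀ x ∈ r.vars, θ x ∈ U := by
  intro x hx
  rcases hsafe with hs | rfl
  · obtain ⟨c, hc, hxc⟩ := hs r hr x hx
    exact Atom.subst_mem_of_inst_args_mem (hpos c hc) hxc
  · exact hθ x hx

/-- The constants of the rules that the rewriting processes lie in `U'`. -/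
def ReachedConstsIn (σ : SIPSChoice Pos V C) (Q : Atom Pos (Term V C)) (P : Program Pos V C)
    (U' : Set C) : Prop :=
  ∀ r ∈ P, ∀ a ∈ r.head, ∀ α, Reached σ Q P a.pred α → ∀ b ∈ r.atoms, ∀ c ∈ b.consts, c ∈ U'

lemma ReachedConstsIn.inst_args_mem (h : ReachedConstsIn σ Q P U') {r : Rule Pos (Term V C)}
    (hr : r ∈ P) {a : Atom Pos (Term V C)} (ha : a ∈ r.head) {α : Adornment Pos a.pred}
    (hα : Reached σ Q P a.pred α) {θ : V → C} (hθ : ∀ x ∈ r.vars, θ x ∈ U')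
    {b : Atom Pos (Term V C)} (hb : b ∈ r.atoms) (i : Pos b.pred) : (b.inst θ).args i ∈ U' :=
  Atom.inst_args_mem (fun x hx => hθ x ⟨b, hb, hx⟩) (h r hr a ha α hα b hb) i

/-- The relevant atoms form a splitting set, up to instances whose body is false for a relevant
reason: if an IDB head atom `a` of an instance is relevant, then some relevant positive body atom is
false, or the instance lies over `U'`, its positive body is true and a magic version of `a` is
in `N`. -/
lemma IsMagicModel.relevant_cases (hN : IsMagicModel σ Q P U' F I N)
    (hover : ∀ A : Atom Pos C, A.lift ∈ N → ∀ i, A.args i ∈ U')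
    (hr' : ReachedConstsIn σ Q P U') (hsafe : SafeProgram P ∨ U = U')
    {r : Rule Pos (Term V C)} (hr : r ∈ P) {a : Atom Pos (Term V C)} (ha : a ∈ r.head)
    {θ : V → C} (hθ : ∀ x ∈ r.vars, θ x ∈ U) (hE : ¬ IsEDB P a.pred)
    (hrel : Relevant σ Q P U' N (a.inst θ)) :
    (∃ c ∈ r.pos, (c.inst θ).lift ∉ N ∧ Relevant σ Q P U' N (c.inst θ)) ∨
    ∃ α, Reached σ Q P a.pred α ∧ (∀ x ∈ r.vars, θ x ∈ U') ∧ (a.inst θ).magic α ∈ N ∧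
      ∀ c ∈ r.pos, (c.inst θ).lift ∈ N := by
  obtain ⟨α, hα, h⟩ : ∃ α : Adornment Pos a.pred, Reached σ Q P a.pred α ∧
    ((a.inst θ).magic α ∈ N ∨ ∃ i, (a.inst θ).args i ∉ U') := hrel.resolve_left hE
  by_cases hθ' : ∀ x ∈ r.vars, θ x ∈ U'
  · have haN : (a.inst θ).magic α ∈ N := by
      refine h.resolve_right ?_
      rintro ⟨i, hi⟩
      exact hi (hr'.inst_args_mem hr ha hα hθ' (Rule.mem_atoms.2 (Or.inl ha)) i)
    by_cases hpos : ∀ c ∈ r.pos, (c.inst θ).lift ∈ N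
    · exact Or.inr ⟨α, hα, hθ', haN, hpos⟩
    · push Not at hpos
      obtain ⟨c, hc, hcN⟩ := hpos
      exact Or.inl (hN.exists_relevant_false hr ha hα hθ' haN hc hcN)
  · rcases hsafe with hs | rfl
    · push Not at hθ'
      obtain ⟨x, hx, hxU⟩ := hθ'
      obtain ⟨c, hc, i, hi⟩ := hs r hr x hx
      -- by safety, the value outside `U'` is an argument of a positive body atom
      have hout : (c.inst θ).args i ∉ U' := by
        change Term.subst θ (c.args i) ∉ U'
        rwa [hi]
      refine Or.inl ⟨c, hc, fun hcN => hout (hover (c.inst θ) hcN i), ?_⟩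
      by_cases hcE : IsEDB P c.pred
      · exact Or.inl hcE
      · exact Or.inr ⟨_, .adorn r hr a ha α hα c ⟨Or.inr (Or.inl hc), hcE⟩, Or.inr ⟨i, hout⟩⟩
    · exact (hθ' hθ).elim

/-- The atoms of a model of `P ∪ F ∪ E` that are relevant for a magic model `N` but not in `N` form
an unfounded set: a minimal model contains none of them. -/
lemma IsMagicModel.mem_of_relevant (hN : IsMagicModel σ Q P U' F I N)
    (hM : Minimal (IsLiftModel P U (F ∪ E) M) M)
    (hIM : ∀ A : Atom Pos C, A.lift ∈ I → A.lift ∈ M)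
    (hNM : ∀ A : Atom Pos C, A.lift ∈ N → A.lift ∈ M) (hEN : E ⊆ N)
    (hover : ∀ A : Atom Pos C, A.lift ∈ N → ∀ i, A.args i ∈ U')
    (hr' : ReachedConstsIn σ Q P U') (hsafe : SafeProgram P ∨ U = U')
    {A : Atom Pos C} (hA : Relevant σ Q P U' N A) (hAM : A.lift ∈ M) : A.lift ∈ N := by
  let K : Set (Atom (MPos Pos) C) :=
    {B | ∃ A : Atom Pos C, B = A.lift ∧ Relevant σ Q P U' N A ∧ A.lift ∉ N}
  have hK : ∀ A : Atom Pos C, A.lift ∈ K ↔ Relevant σ Q P U' N A ∧ A.lift ∉ N := by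
    refine fun A => ⟨?_, fun h => ⟨A, rfl, h⟩⟩
    rintro ⟨A', h, h'⟩
    rwa [Atom.lift_injective h]
  have hmod : IsLiftModel P U (F ∪ E) M (M \ K) := by
    refine ⟨fun B hB => ⟨hM.prop.1 hB, ?_⟩, fun r hr θ hθ hneg hpos => ?_⟩
    · rintro ⟨A, rfl, -, hAN⟩
      exact hAN (hB.elim (fun h => hN.facts h) fun h => hEN h)
    · obtain ⟨a, ha, haM⟩ := hM.prop.2 r hr θ hθ hneg fun c hc => (hpos c hc).1
      by_cases haK : (a.inst θ).lift ∈ K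
      swap
      · exact ⟨a, ha, haM, haK⟩
      obtain ⟨hrel, haN⟩ := (hK _).1 haK
      have hE : ¬ IsEDB P a.pred := fun hE => haN (hN.edb r (mem_EDB_of_isEDB hr ha hE) a ha θ)
      rcases hN.relevant_cases hover hr' hsafe hr ha hθ hE hrel with
        ⟨c, hc, hcN, hcR⟩ | ⟨α, hα, hθ', haN', hposN⟩
      · exact ((hpos c hc).2 ((hK _).2 ⟨hcR, hcN⟩)).elim
      · have had : ∀ b ∈ r.head, b ≠ a → AdornedAtom P r a b := fun b hb hba => by
          refine ⟨Or.inl ⟨hb, hba⟩, not_isEDB_of_mem_head hr hb fun hf => hba ?_⟩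
          exact Finset.card_le_one.1 hf.2.2.1.le b hb a ha
        obtain ⟨b, hb, hbN⟩ := hN.modified r hr a ha α hα θ hθ'
          (fun b hb hbI => hneg b hb (hIM _ hbI)) haN'
          (fun b hb hba => hN.magic_mem hr ha hα hθ' haN' hposN (had b hb hba)) hposN
        exact ⟨b, hb, hNM _ hbN, fun h => ((hK _).1 h).2 hbN⟩
  by_contra hAN
  exact (hM.le_of_le hmod Set.sdiff_subset hAM).2 ((hK A).2 ⟨hA, hAN⟩)

/-- Every instance of the query is relevant, because of the magic seed. -/
lemma IsMagicModel.relevant_query (hN : IsMagicModel σ Q P U' F I N) (θ : V → C) :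
    Relevant σ Q P U' N (Q.inst θ) :=
  Or.inr ⟨queryAdornment Q, .query, Or.inl (hN.seed θ)⟩

end Relevance

/-! ### Universes of the original and the rewritten program -/

section Universes

variable {Pr : Type*} {Pos : Pr → Type*} {V C : Type*}
  {σ : SIPSChoice Pos V C} {Q : Atom Pos (Term V C)} {P : Program Pos V C}

lemma programConsts_liftProgram : programConsts (liftProgram P) = programConsts P := by
  classical
  ext c
  constructor
  · rintro ⟨_, ⟨r, hr, rfl⟩, a, ha, hc⟩
    simp only [Rule.mem_atoms, Rule.lift, Finset.mem_image] at ha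
    rcases ha with ⟨b, hb, rfl⟩ | ⟨b, hb, rfl⟩ | ⟨b, hb, rfl⟩
    · exact ⟨r, hr, b, Rule.mem_atoms.2 (Or.inl hb), hc⟩
    · exact ⟨r, hr, b, Rule.mem_atoms.2 (Or.inr (Or.inl hb)), hc⟩
    · exact ⟨r, hr, b, Rule.mem_atoms.2 (Or.inr (Or.inr hb)), hc⟩
  · rintro ⟨r, hr, a, ha, hc⟩
    exact ⟨r.lift, ⟨r, hr, rfl⟩, a.lift, mem_lift_atoms ha, hc⟩

lemma programConsts_DMS_subset (hQ : Q.consts ⊆ programConsts P) :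
    programConsts (DMS σ Q P) ⊆ programConsts P := by
  classical
  rintro c ⟨m, ((rfl | ⟨r, hr, a, ha, α, hα, b, hb, rfl⟩) | ⟨r, hr, a, ha, α, hα, rfl⟩) | hm,
    d, hd, hc⟩
  · simp only [Rule.mem_atoms, seedRule, Finset.mem_singleton, Finset.notMem_empty, or_false] at hd
    subst hd
    obtain ⟨i, hi⟩ := hc
    exact hQ ⟨i.1, hi⟩
  · obtain ⟨d', hd', -, h⟩ := exists_of_mem_magicRule_atoms ha hb hd
    exact ⟨r, hr, d', hd', h hc⟩
  · obtain ⟨d', hd', -, h⟩ := exists_of_mem_modifiedRule_atoms ha hd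
    exact ⟨r, hr, d', hd', h hc⟩
  · obtain ⟨r, hr, a, ha, hc⟩ : c ∈ programConsts (EDB P) := by
      rw [← programConsts_liftProgram]
      exact ⟨m, hm, d, hd, hc⟩
    exact ⟨r, hr.1, a, ha, hc⟩

variable [Inhabited C] {F : Set (Atom (MPos Pos) C)}

variable (σ Q P F) in
lemma reachedConstsIn_programUniverse :
    ReachedConstsIn σ Q P (programUniverse (withFacts (DMS σ Q P) F)) :=
  fun r hr a ha α hα _ hb _ hc => mem_programUniverse_of_mem_consts
    (Or.inl (Or.inl (Or.inr ⟨r, hr, a, ha, α, hα, rfl⟩)))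
    (lift_mem_modifiedRule_atoms (σ r a ha α) hb) hc

/-- If every constant of `P` occurs in the rewritten program, both programs have the same
universe. -/
lemma programUniverse_DMS (hQ : Q.consts ⊆ programConsts P)
    (h : programConsts P ⊆ programConsts (DMS σ Q P)) :
    programUniverse (withFacts (liftProgram P) F) =
      programUniverse (withFacts (DMS σ Q P) F) := by
  apply programUniverse_congr
  rw [programConsts_withFacts, programConsts_withFacts, programConsts_liftProgram,
    h.antisymm (programConsts_DMS_subset hQ)]

variable (F) in
/-- Instances of atoms of `P` over the universe lie in the base. -/
lemma inst_lift_mem_programBase {r : Rule Pos (Term V C)} (hr : r ∈ P) {a : Atom Pos (Term V C)}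
    (ha : a ∈ r.atoms) {θ : V → C}
    (hθ : ∀ x ∈ r.vars, θ x ∈ programUniverse (withFacts (liftProgram P) F)) :
    (a.inst θ).lift ∈ programBase (withFacts (liftProgram P) F) :=
  ⟨⟨r.lift, Or.inl ⟨r, hr, rfl⟩, a.lift, mem_lift_atoms ha, rfl⟩, Atom.inst_args_mem
    (fun x hx => hθ x ⟨a, ha, hx⟩) fun _ hc => mem_programUniverse_of_mem_consts
      (Or.inl ⟨r, hr, rfl⟩) (mem_lift_atoms ha) hc⟩

lemma fact_mem_programBase {Pr : Type*} {Pos : Pr → Type*} {P : Program Pos V C}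
    {F : Set (Atom Pos C)} {A : Atom Pos C} (hA : A ∈ F) : A ∈ programBase (withFacts P F) :=
  ⟨⟨_, Or.inr ⟨A, hA, rfl⟩, A.map Term.const,
    Rule.mem_atoms.2 (Or.inl (Finset.mem_singleton_self _)), rfl⟩,
    args_mem_programUniverse_withFacts P hA⟩

lemma mem_answerSets_liftProgram_iff {M : Set (Atom (MPos Pos) C)} :
    M ∈ answerSets (withFacts (liftProgram P) F) ↔
      Minimal (IsLiftModel P (programUniverse (withFacts (liftProgram P) F)) F M) M := by
  rw [mem_answerSets_iff]
  simp only [Minimal, models_liftProgram_iff]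

lemma mem_answerSets_DMS_iff {N : Set (Atom (MPos Pos) C)} :
    N ∈ answerSets (withFacts (DMS σ Q P) F) ↔
      Minimal (IsMagicModel σ Q P (programUniverse (withFacts (DMS σ Q P) F)) F N) N := by
  rw [mem_answerSets_iff]
  simp only [Minimal, models_DMS_iff]

end Universes

/-! ### From the rewritten to the original program -/

section Soundness

variable {Pr : Type*} {Pos : Pr → Type*} {V C : Type*} [Inhabited C]
  {σ : SIPSChoice Pos V C} {Q : Atom Pos (Term V C)} {P : Program Pos V C}
  {F N M : Set (Atom (MPos Pos) C)}

/-- An answer set of the rewritten program contains no atom of the original language outside the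
base of the original program, even if the universe of the rewritten program is the arbitrary
constant and does not consist of constants of `P`. -/
lemma lift_mem_programBase_of_mem_answerSets_DMS
    (hsafe : SafeProgram P ∨ programUniverse (withFacts (liftProgram P) F) =
      programUniverse (withFacts (DMS σ Q P) F))
    (hN : N ∈ answerSets (withFacts (DMS σ Q P) F)) (A : Atom Pos C) (hA : A.lift ∈ N) :
    A.lift ∈ programBase (withFacts (liftProgram P) F) := by
  rw [mem_answerSets_DMS_iff] at hN
  let J : Set (Atom (MPos Pos) C) :=
    {B ∈ N | ∀ A : Atom Pos C, B = A.lift → B ∈ programBase (withFacts (liftProgram P) F)}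
  have hp := hN.prop
  have hJ : IsMagicModel σ Q P (programUniverse (withFacts (DMS σ Q P) F)) F N J := by
    refine ⟨fun B hB => ⟨hp.facts hB, fun _ _ => fact_mem_programBase hB⟩,
      fun θ => ⟨hp.seed θ, fun A h => (Atom.magic_ne_lift _ _ _ h).elim⟩,
      fun r hr a ha α hα b hb θ hθ haJ hc => ⟨hp.magic r hr a ha α hα b hb θ hθ haJ.1
        fun c h1 h2 h3 => (hc c h1 h2 h3).1, fun A h => (Atom.magic_ne_lift _ _ _ h).elim⟩,
      fun r hr a ha α hα θ hθ hneg haJ hhead hpos => ?_,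
      fun r hr a ha θ => ⟨hp.edb r hr a ha θ, fun _ _ => ?_⟩⟩
    · obtain ⟨b, hb, hbN⟩ := hp.modified r hr a ha α hα θ hθ hneg haJ.1
        (fun b hb hba => (hhead b hb hba).1) fun b hb => (hpos b hb).1
      exact ⟨b, hb, hbN, fun _ _ => inst_lift_mem_programBase F hr (Rule.mem_atoms.2 (Or.inl hb))
        (subst_mem_of_safe hsafe hr hθ fun c hc => ((hpos c hc).2 _ rfl).2)⟩
    · exact inst_lift_mem_programBase F hr.1 (Rule.mem_atoms.2 (Or.inl ha))
        fun x hx => ((isFact_of_mem_EDB hr).not_mem_vars x hx).elim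
  exact (hN.le_of_le hJ (Set.sep_subset _ _) hA).2 A rfl

/-- An answer set `N` of the rewritten program extends to one of the original program that agrees
with it on the query.  Super-consistency provides an answer set of the original program together
with the original atoms of `N` as facts; these facts turn out to be redundant. -/
lemma exists_answerSet_of_mem_answerSets_DMS [∀ p, Finite (Pos p)] (hfin : P.Finite)
    (hF : F.Finite) (hsc : SuperConsistent (liftProgram P))
    (hsafe : SafeProgram P ∨ programUniverse (withFacts (liftProgram P) F) =
      programUniverse (withFacts (DMS σ Q P) F))
    (hN : N ∈ answerSets (withFacts (DMS σ Q P) F)) :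
    ∃ M ∈ answerSets (withFacts (liftProgram P) F),
      ∀ θ : V → C, (Q.inst θ).lift ∈ N ↔ (Q.inst θ).lift ∈ M := by
  have hbase := lift_mem_programBase_of_mem_answerSets_DMS hsafe hN
  have hover : ∀ A : Atom Pos C, A.lift ∈ N →
      ∀ i, A.args i ∈ programUniverse (withFacts (DMS σ Q P) F) := fun A hA => (hN.1 hA).2
  have hr' := reachedConstsIn_programUniverse σ Q P F
  rw [mem_answerSets_DMS_iff] at hN
  have hp := hN.prop
  let E : Set (Atom (MPos Pos) C) := {B ∈ N | ∃ A : Atom Pos C, B = A.lift}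
  have hEbase : E ⊆ programBase (withFacts (liftProgram P) F) := by
    rintro _ ⟨hB, A, rfl⟩
    exact hbase A hB
  have hE : E.Finite := by
    have : ∀ p : MPred Pos, Finite (MPos Pos p) := by
      rintro (p | ⟨p, α⟩)
      · exact inferInstanceAs (Finite (Pos p))
      · exact inferInstanceAs (Finite {i : Pos p // α i = true})
    exact (finite_programBase ((hfin.image _).union (hF.image _))).subset hEbase
  obtain ⟨M, hM⟩ := hsc (F ∪ E) (hF.union hE)
  rw [mem_answerSets_liftProgram_iff,
    programUniverse_withFacts_union fun A hA => (hEbase hA).2] at hM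
  have hNM : ∀ A : Atom Pos C, A.lift ∈ N → A.lift ∈ M :=
    fun A hA => hM.prop.1 (Or.inr ⟨hA, A, rfl⟩)
  have hrel : ∀ A, Relevant σ Q P _ N A → A.lift ∈ M → A.lift ∈ N := fun A =>
    hp.mem_of_relevant hM hNM hNM (Set.sep_subset _ _) hover hr' hsafe
  refine ⟨M, ?_, fun θ => ⟨hNM _, hrel _ (hp.relevant_query θ)⟩⟩
  rw [mem_answerSets_liftProgram_iff]
  refine ⟨⟨fun A hA => hM.prop.1 (Or.inl hA), hM.prop.2⟩, fun M' hM' hle => ?_⟩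
  suffices hEM : E ⊆ M' from hM.le_of_le ⟨Set.union_subset hM'.1 hEM, hM'.2⟩ hle
  -- the original atoms of `N` outside `M'` can be removed from `N`
  let J : Set (Atom (MPos Pos) C) := {B ∈ N | ∀ A : Atom Pos C, B = A.lift → B ∈ M'}
  have hJ : IsMagicModel σ Q P (programUniverse (withFacts (DMS σ Q P) F)) F N J := by
    refine ⟨fun B hB => ⟨hp.facts hB, fun _ _ => hM'.1 hB⟩,
      fun θ => ⟨hp.seed θ, fun A h => (Atom.magic_ne_lift _ _ _ h).elim⟩,
      fun r hr a ha α hα b hb θ hθ haJ hc => ⟨hp.magic r hr a ha α hα b hb θ hθ haJ.1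
        fun c h1 h2 h3 => (hc c h1 h2 h3).1, fun A h => (Atom.magic_ne_lift _ _ _ h).elim⟩,
      fun r hr a ha α hα θ hθ hneg haJ hhead hpos => ?_,
      fun r hr a ha θ => ⟨hp.edb r hr a ha θ, fun _ _ => ?_⟩⟩
    · have hposN : ∀ c ∈ r.pos, (c.inst θ).lift ∈ N := fun c hc => (hpos c hc).1
      have hnegM : ∀ b ∈ r.neg, (b.inst θ).lift ∉ M := fun b hb hbM => hneg b hb <| by
        refine hrel _ ?_ hbM
        by_cases hbE : IsEDB P b.pred
        · exact Or.inl hbE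
        · have had : AdornedAtom P r a b := ⟨Or.inr (Or.inr hb), hbE⟩
          exact Or.inr ⟨_, .adorn r hr a ha α hα b had,
            Or.inl (hp.magic_mem hr ha hα hθ haJ.1 hposN had)⟩
      obtain ⟨b, hb, hbM'⟩ := hM'.2 r hr θ (subst_mem_of_safe hsafe hr hθ
        fun c hc => (hbase _ (hposN c hc)).2) hnegM fun c hc => (hpos c hc).2 _ rfl
      refine ⟨b, hb, hrel _ ?_ (hle hbM'), fun _ _ => hbM'⟩
      by_cases hba : b = a
      · subst hba
        exact Or.inr ⟨α, hα, Or.inl haJ.1⟩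
      · by_cases hbE : IsEDB P b.pred
        · exact Or.inl hbE
        · exact Or.inr ⟨_, .adorn r hr a ha α hα b ⟨Or.inl ⟨hb, hba⟩, hbE⟩,
            Or.inl (hhead b hb hba).1⟩
    · have hf := isFact_of_mem_EDB hr
      obtain ⟨b, hb, hbM'⟩ := hM'.2 r hr.1 θ (fun x hx => (hf.not_mem_vars x hx).elim)
        (by simp [hf.2.1]) (by simp [hf.1])
      rwa [Finset.card_le_one.1 hf.2.2.1.le a ha b hb]
  rintro _ ⟨hB, A, rfl⟩
  exact (hN.le_of_le hJ (Set.sep_subset _ _) hB).2 A rfl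

end Soundness

/-! ### From the original to the rewritten program -/

section Completeness

variable {Pr : Type*} {Pos : Pr → Type*} {V C : Type*}

/-- The facts `F` and the magic atoms that the seed and the magic rules derive from them when atoms
of the original language are evaluated in `M`; rules are instantiated over `U`. -/
inductive MagicDerived (σ : SIPSChoice Pos V C) (Q : Atom Pos (Term V C)) (P : Program Pos V C)
    (U : Set C) (F M : Set (Atom (MPos Pos) C)) : Atom (MPos Pos) C → Prop
  | fact (B : Atom (MPos Pos) C) (hB : B ∈ F) : MagicDerived σ Q P U F M B
  | seed (θ : V → C) : MagicDerived σ Q P U F M ((Q.inst θ).magic (queryAdornment Q))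
  | step (r : Rule Pos (Term V C)) (hr : r ∈ P) (a : Atom Pos (Term V C)) (ha : a ∈ r.head)
      (α : Adornment Pos a.pred) (hα : Reached σ Q P a.pred α) (b : Atom Pos (Term V C))
      (hb : AdornedAtom P r a b) (θ : V → C)
      (hθ : ∀ x ∈ (magicRule (σ r a ha α) b).vars, θ x ∈ U)
      (haD : MagicDerived σ Q P U F M ((a.inst θ).magic α))
      (hc : ∀ c ∈ r.atoms, (σ r a ha α).prec c b → c ≠ a → (c.inst θ).lift ∈ M) :
      MagicDerived σ Q P U F M ((b.inst θ).magic ((σ r a ha α).adorn b))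

variable {σ : SIPSChoice Pos V C} {Q : Atom Pos (Term V C)} {P : Program Pos V C}
  {U U' : Set C} {F N M : Set (Atom (MPos Pos) C)}

lemma MagicDerived.mem_of_lift {A : Atom Pos C} (h : MagicDerived σ Q P U F M A.lift) :
    A.lift ∈ F := by
  generalize hB : A.lift = B at h
  cases h with
  | fact _ h => exact h
  | seed θ => exact (Atom.magic_ne_lift _ _ _ hB.symm).elim
  | step => exact (Atom.magic_ne_lift _ _ _ hB.symm).elim

lemma vars_magicRule_mono {r : Rule Pos (Term V C)} {a b c : Atom Pos (Term V C)}
    {α : Adornment Pos a.pred} (s : SIPS r a α) (hcb : s.prec c b) (hca : c ≠ a) :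
    (magicRule s c).vars ⊆ (magicRule s b).vars := by
  classical
  have key : ∀ d, s.prec d b → d ≠ a → d.lift ∈ (magicRule s b).atoms := fun d hd hda =>
    Rule.mem_atoms.2 (Or.inr (Or.inl (Finset.mem_union_right _ (Finset.mem_image_of_mem _
      (Finset.mem_filter.2 ⟨(s.prec_mem d b hd).1, hd, hda⟩)))))
  rintro x ⟨d, hd, hx⟩
  rw [Rule.mem_atoms] at hd
  simp only [magicRule, Finset.mem_image, Finset.mem_union, Finset.mem_singleton,
    Finset.mem_filter, Finset.notMem_empty, or_false] at hd
  rcases hd with rfl | rfl | ⟨d, ⟨-, hdc, hda⟩, rfl⟩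
  · obtain ⟨i, hi⟩ := hx
    exact ⟨c.lift, key c hcb hca, i.1, hi⟩
  · exact ⟨a.magic α, Rule.mem_atoms.2 (Or.inr (Or.inl (Finset.mem_union_left _
      (Finset.mem_singleton_self _)))), hx⟩
  · exact ⟨d.lift, key d (s.prec_trans d c b hdc hcb) hda, hx⟩

/-- A magic model that contains its relevant atoms of `M` contains everything derived with `M`. -/
lemma IsMagicModel.mem_of_magicDerived {I : Set (Atom (MPos Pos) C)}
    (hN : IsMagicModel σ Q P U' F I N)
    (hrel : ∀ A, Relevant σ Q P U' N A → A.lift ∈ M → A.lift ∈ N) {B : Atom (MPos Pos) C}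
    (hB : MagicDerived σ Q P U' F M B) : B ∈ N := by
  induction hB with
  | fact B hB => exact hN.facts hB
  | seed θ => exact hN.seed θ
  | step r hr a ha α hα b hb θ hθ _ hc ih =>
    refine hN.magic r hr a ha α hα b hb θ hθ ih fun c hcr => ?_
    let s := σ r a ha α
    have : IsStrictOrder _ s.prec := { irrefl := s.prec_irrefl, trans := s.prec_trans }
    refine Set.WellFoundedOn.induction
      (P := fun c => s.prec c b → c ≠ a → (c.inst θ).lift ∈ N)
      (Finset.wellFoundedOn (r := s.prec) r.atoms) hcr ?_
    intro c hcr ihc hcb hca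
    refine hrel _ ?_ (hc c hcr hcb hca)
    by_cases hcE : IsEDB P c.pred
    · exact Or.inl hcE
    · have had : AdornedAtom P r a c := ⟨Or.inr (Or.inl (s.mem_pos_of_prec hcb hca)), hcE⟩
      exact Or.inr ⟨_, .adorn r hr a ha α hα c had, Or.inl <|
        hN.magic r hr a ha α hα c had θ (fun x hx => hθ x (vars_magicRule_mono s hcb hca hx)) ih
          fun d hd hdc hda => ihc d hd hdc (s.prec_trans d c b hdc hcb) hda⟩

variable (σ Q P U' F M) in
/-- The derived magic atoms and facts, together with the atoms of `M` over `U'` that are relevant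
for them. -/
def magicPart : Set (Atom (MPos Pos) C) :=
  {B | MagicDerived σ Q P U' F M B ∨ ∃ A : Atom Pos C, B = A.lift ∧ A.lift ∈ M ∧
    (∀ i, A.args i ∈ U') ∧ (IsEDB P A.pred ∨
      ∃ α, Reached σ Q P A.pred α ∧ MagicDerived σ Q P U' F M (A.magic α))}

lemma lift_mem_of_mem_magicPart (hF : F ⊆ M) (A : Atom Pos C)
    (hA : A.lift ∈ magicPart σ Q P U' F M) : A.lift ∈ M := by
  rcases hA with h | ⟨_, h, hM, -⟩
  · exact hF h.mem_of_lift
  · rwa [h]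

lemma magicDerived_of_mem_magicPart {A : Atom Pos C} {α : Adornment Pos A.pred}
    (hA : A.magic α ∈ magicPart σ Q P U' F M) : MagicDerived σ Q P U' F M (A.magic α) := by
  rcases hA with h | ⟨_, h, -⟩
  · exact h
  · exact (Atom.magic_ne_lift _ _ _ h).elim

/-- A model of the original program restricts to a model of the rewritten program. -/
lemma isMagicModel_magicPart (hM : IsLiftModel P U F M M)
    (hMU : ∀ A : Atom Pos C, A.lift ∈ M → ∀ i, A.args i ∈ U)
    (hr' : ReachedConstsIn σ Q P U')
    (hedb : ∀ r ∈ EDB P, ∀ a ∈ r.head, ∀ c ∈ a.consts, c ∈ U')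
    (hsafe : SafeProgram P ∨ U = U') :
    IsMagicModel σ Q P U' F (magicPart σ Q P U' F M) (magicPart σ Q P U' F M) := by
  have hNM := lift_mem_of_mem_magicPart (σ := σ) (Q := Q) (P := P) (U' := U') hM.1
  refine ⟨fun B hB => Or.inl (.fact B hB), fun θ => Or.inl (.seed θ),
    fun r hr a ha α hα b hb θ hθ haN hc => Or.inl (.step r hr a ha α hα b hb θ hθ
      (magicDerived_of_mem_magicPart haN) fun c h1 h2 h3 => hNM _ (hc c h1 h2 h3)),
    fun r hr a ha α hα θ hθ hneg haN hhead hpos => ?_, fun r hr a ha θ => ?_⟩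
  · have hposM : ∀ c ∈ r.pos, (c.inst θ).lift ∈ M := fun c hc => hNM _ (hpos c hc)
    have hargs : ∀ b ∈ r.atoms, ∀ i, (b.inst θ).args i ∈ U' :=
      fun b hb => hr'.inst_args_mem hr ha hα hθ hb
    have hnegM : ∀ b ∈ r.neg, (b.inst θ).lift ∉ M := fun b hb hbM => hneg b hb <| by
      refine Or.inr ⟨_, rfl, hbM, hargs b (Rule.mem_atoms.2 (Or.inr (Or.inr hb))), ?_⟩
      by_cases hbE : IsEDB P b.pred
      · exact Or.inl hbE
      · have had : AdornedAtom P r a b := ⟨Or.inr (Or.inr hb), hbE⟩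
        exact Or.inr ⟨_, .adorn r hr a ha α hα b had, .step r hr a ha α hα b had θ
          (fun x hx => hθ x (vars_magicRule_subset ha _ had hx))
          (magicDerived_of_mem_magicPart haN) fun c _ hcb hca =>
            hposM c ((σ r a ha α).mem_pos_of_prec hcb hca)⟩
    obtain ⟨b, hb, hbM⟩ := hM.2 r hr θ
      (subst_mem_of_safe hsafe hr hθ fun c hc => hMU _ (hposM c hc)) hnegM hposM
    refine ⟨b, hb, Or.inr ⟨_, rfl, hbM, hargs b (Rule.mem_atoms.2 (Or.inl hb)), ?_⟩⟩
    by_cases hba : b = a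
    · subst hba
      exact Or.inr ⟨α, hα, magicDerived_of_mem_magicPart haN⟩
    · by_cases hbE : IsEDB P b.pred
      · exact Or.inl hbE
      · exact Or.inr ⟨_, .adorn r hr a ha α hα b ⟨Or.inl ⟨hb, hba⟩, hbE⟩,
          magicDerived_of_mem_magicPart (hhead b hb hba)⟩
  · have hf := isFact_of_mem_EDB hr
    obtain ⟨b, hb, hbM⟩ := hM.2 r hr.1 θ (fun x hx => (hf.not_mem_vars x hx).elim)
      (by simp [hf.2.1]) (by simp [hf.1])
    obtain rfl := Finset.card_le_one.1 hf.2.2.1.le a ha b hb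
    exact Or.inr ⟨_, rfl, hbM, Atom.inst_args_mem
      (fun x hx => (hf.not_mem_vars x ⟨a, Rule.mem_atoms.2 (Or.inl ha), hx⟩).elim)
      (hedb r hr a ha), Or.inl (hr.2 a ha)⟩

/-- An answer set of the original program restricts to one of the rewritten program that agrees
with it on the query. -/
lemma exists_answerSet_DMS_of_mem_answerSets [Inhabited C]
    (hsafe : SafeProgram P ∨ programUniverse (withFacts (liftProgram P) F) =
      programUniverse (withFacts (DMS σ Q P) F))
    (hM : M ∈ answerSets (withFacts (liftProgram P) F)) :
    ∃ N ∈ answerSets (withFacts (DMS σ Q P) F),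
      ∀ θ : V → C, (Q.inst θ).lift ∈ N ↔ (Q.inst θ).lift ∈ M := by
  have hMU : ∀ A : Atom Pos C, A.lift ∈ M →
      ∀ i, A.args i ∈ programUniverse (withFacts (liftProgram P) F) := fun A hA => (hM.1 hA).2
  have hr' := reachedConstsIn_programUniverse σ Q P F
  have hedb : ∀ r ∈ EDB P, ∀ a ∈ r.head, ∀ c ∈ a.consts,
      c ∈ programUniverse (withFacts (DMS σ Q P) F) := fun r hr a ha c hc =>
    mem_programUniverse_of_mem_consts (Or.inl (Or.inr ⟨r, hr, rfl⟩))
      (mem_lift_atoms (Rule.mem_atoms.2 (Or.inl ha))) hc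
  rw [mem_answerSets_liftProgram_iff] at hM
  set U' := programUniverse (withFacts (DMS σ Q P) F) with hU'
  have hN := isMagicModel_magicPart hM.prop hMU hr' hedb hsafe
  have hNM := lift_mem_of_mem_magicPart (σ := σ) (Q := Q) (P := P) (U' := U') hM.prop.1
  have hover : ∀ A : Atom Pos C, A.lift ∈ magicPart σ Q P U' F M → ∀ i, A.args i ∈ U' := by
    rintro A (h | ⟨B, h, -, hB, -⟩)
    · exact args_mem_programUniverse_withFacts (DMS σ Q P) h.mem_of_lift
    · rwa [Atom.lift_injective h]
  have key : ∀ N ⊆ magicPart σ Q P U' F M,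
      IsMagicModel σ Q P U' F (magicPart σ Q P U' F M) N →
      ∀ A, Relevant σ Q P U' N A → A.lift ∈ M → A.lift ∈ N := fun N hle h A =>
    h.mem_of_relevant (E := ∅) (by rwa [Set.union_empty]) hNM (fun A hA => hNM A (hle hA))
      (Set.empty_subset _) (fun A hA => hover A (hle hA)) hr' hsafe
  refine ⟨magicPart σ Q P U' F M, mem_answerSets_DMS_iff.2 ⟨hN, fun N h hle => ?_⟩,
    fun θ => ⟨hNM _, key _ subset_rfl hN _ (hN.relevant_query θ)⟩⟩
  have hD : ∀ B, MagicDerived σ Q P U' F M B → B ∈ N :=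
    fun B => h.mem_of_magicDerived (key N hle h)
  rintro B (hB | ⟨A, rfl, hAM, -, hA⟩)
  · exact hD B hB
  · refine key N hle h A ?_ hAM
    rcases hA with hA | ⟨α, hα, hA⟩
    · exact Or.inl hA
    · exact Or.inr ⟨α, hα, Or.inl (hD _ hA)⟩

end Completeness

end ASP

theorem mainTheorem1 {Pr : Type*} {Pos : Pr → Type*} [∀ p, Finite (Pos p)] {V C : Type*}
    [Inhabited C] (σ : ASP.SIPSChoice Pos V C)
    (P : ASP.Program Pos V C) (hfin : P.Finite)
    (hsc : ASP.SuperConsistent (ASP.liftProgram P))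
    (Q : ASP.Atom Pos (ASP.Term V C)) (hQ : Q.consts ⊆ ASP.programConsts P)
    (hU : ASP.SafeProgram P ∨ ASP.programConsts P ⊆ ASP.programConsts (ASP.DMS σ Q P)) :
    ASP.BraveEquiv Q.lift (ASP.DMS σ Q P) (ASP.liftProgram P) ∧
    ASP.CautiousEquiv Q.lift (ASP.DMS σ Q P) (ASP.liftProgram P) := by
  have hsafe : ∀ F, ASP.SafeProgram P ∨
      ASP.programUniverse (ASP.withFacts (ASP.liftProgram P) F) =
        ASP.programUniverse (ASP.withFacts (ASP.DMS σ Q P) F) :=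
    fun F => hU.imp_right (ASP.programUniverse_DMS hQ)
  have sound := fun F (hF : F.Finite) N
      (hN : N ∈ ASP.answerSets (ASP.withFacts (ASP.DMS σ Q P) F)) =>
    ASP.exists_answerSet_of_mem_answerSets_DMS hfin hF hsc (hsafe F) hN
  have complete := fun F M (hM : M ∈ ASP.answerSets (ASP.withFacts (ASP.liftProgram P) F)) =>
    ASP.exists_answerSet_DMS_of_mem_answerSets (hsafe F) hM
  refine ⟨fun F hF => ?_, fun F hF => ?_⟩ <;> ext θ <;> constructor
  · rintro ⟨N, hN, h⟩
    obtain ⟨M, hM, hNM⟩ := sound F hF.1 N hN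
    exact ⟨M, hM, (hNM θ).1 h⟩
  · rintro ⟨M, hM, h⟩
    obtain ⟨N, hN, hNM⟩ := complete F M hM
    exact ⟨N, hN, (hNM θ).2 h⟩
  · intro h M hM
    obtain ⟨N, hN, hNM⟩ := complete F M hM
    exact (hNM θ).1 (h N hN)
  · intro h N hN
    obtain ⟨M, hM, hNM⟩ := sound F hF.1 N hN
    exact (hNM θ).2 (h M hM)
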